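/- Let $N\ge 5$ be an integer. Let $V:(0,+\infty)\to[0,+\infty]$ be a measurable function with $V\in L^1_{\rm loc}((0,+\infty))$, and let $K:(0,+\infty)\to(0,+\infty)$ be a measurable function with $K\in L^s_{\rm loc}((0,+\infty))$ for some $s>1$. Let $D^{2,2}(\mathbb{R}^N)$ be the space of all $u\in L^{2N/(N-4)}(\mathbb{R}^N)$ whose weak second derivatives all belong to $L^2(\mathbb{R}^N)$, and let $$H^2_{V,r}:=\Big\{u\in D^{2,2}(\mathbb{R}^N)\ \text{radial}:\ \int_{\mathbb{R}^N}V(|x|)|u|^2\,dx<\infty\Big\},\qquad \|u\|:=\Big(\int_{\mathbb{R}^N}|\Delta u|^2+V(|x|)|u|^2\,dx\Big)^{1/2}.$$ With $B_R:=\{x\in\mathbb{R}^N:|x|<R\}$, define for $q>1$ and $R>0$ $$\mathcal{R}_\infty(q,R):=\sup_{u,h\in H^2_{V,r},\ \|u\|=\|h\|=1}\ \int_{\mathbb{R}^N\setminus B_R}K(|x|)\,|u|^{q-1}|h|\,dx\in[0,+\infty].$$ Assume that there is $R_2>0$ such that $V(r)<+\infty$ for almost every $r>R_2$ and $$\operatorname*{ess\,sup}_{r>R_2}\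 \frac{K(r)}{r^{\alpha_\infty}V(r)^{\beta_\infty}}<+\infty\qquad\text{for some }\ 0\le\beta_\infty\le1\ \text{ and }\ \alpha_\infty\in\mathbb{R},$$ where $V(r)^{\beta_\infty}:=1$ if $\beta_\infty=0$, and the quotient is $+\infty$ where its denominator vanishes. Then $$\lim_{R\to+\infty}\mathcal{R}_\infty(q_2,R)=0\qquad\text{for every real }\ q_2>\max\Big\{1,\ 2\beta_\infty,\ 2\,\frac{\alpha_\infty-4\beta_\infty+N}{N-4}\Big\}.$$ -/

import Mathlib

open MeasureTheory Filter Topology Set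
open scoped ENNReal ContDiff

noncomputable section

/-- The Euclidean space `ℝ^N`. -/
abbrev RN (N : ℕ) : Type := EuclideanSpace ℝ (Fin N)

/-- The classical second partial derivative `∂ᵢ ∂ⱼ φ` of a smooth function on `ℝ^N`. -/
def partial2 {N : ℕ} (i j : Fin N) (φ : RN N → ℝ) (x : RN N) : ℝ :=
  iteratedFDeriv ℝ 2 φ x ![EuclideanSpace.single i 1, EuclideanSpace.single j 1]

/-- `g` is the weak (distributional) second derivative `∂ᵢ ∂ⱼ u` of `u` on `ℝ^N`. -/
structure IsWeakPartial2 {N : ℕ} (i j : Fin N) (u g : RN N → ℝ) : Prop where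
  locallyIntegrable_fun : LocallyIntegrable u volume
  locallyIntegrable_deriv : LocallyIntegrable g volume
  integral_eq : ∀ φ : RN N → ℝ, ContDiff ℝ ∞ φ → HasCompactSupport φ →
    ∫ x, u x * partial2 i j φ x = ∫ x, g x * φ x

/-- Weak second derivatives are unique up to null sets. -/
theorem IsWeakPartial2.ae_eq {N : ℕ} {i j : Fin N} {u g g' : RN N → ℝ}
    (h : IsWeakPartial2 i j u g) (h' : IsWeakPartial2 i j u g') : g =ᵐ[volume] g' := by
  refine ae_eq_of_integral_contDiff_smul_eq h.locallyIntegrable_deriv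
    h'.locallyIntegrable_deriv ?_
  intro φ hφ hc
  have e := (h.integral_eq φ hφ hc).symm.trans (h'.integral_eq φ hφ hc)
  simpa only [smul_eq_mul, mul_comm] using e

open Classical in
/-- The weak second derivative `∂ᵢ ∂ⱼ u` (zero if there is none), determined up to null sets. -/
def weakPartial2 {N : ℕ} (i j : Fin N) (u : RN N → ℝ) : RN N → ℝ :=
  if h : ∃ g, IsWeakPartial2 i j u g then h.choose else 0

/-- The weak Laplacian `Δ u = ∑ᵢ ∂ᵢ ∂ᵢ u`. -/
def weakLaplacian {N : ℕ} (u : RN N → ℝ) (x : RN N) : ℝ :=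
  ∑ i, weakPartial2 i i u x

/-- The critical exponent `2** = 2N/(N-4)`. -/
def critExp (N : ℕ) : ℝ≥0∞ := ENNReal.ofReal (2 * (N : ℝ) / ((N : ℝ) - 4))

/-- `u ∈ D^{2,2}(ℝ^N)`: `u ∈ L^{2**}` and all weak second derivatives exist and lie in `L²`. -/
structure MemD22 {N : ℕ} (u : RN N → ℝ) : Prop where
  memLp : MemLp u (critExp N) volume
  memLp_deriv : ∀ i j : Fin N, ∃ g, IsWeakPartial2 i j u g ∧ MemLp g 2 volume

/-- `u(x) = u(|x|)`, in the sense of almost everywhere defined functions. -/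
def IsRadial {N : ℕ} (u : RN N → ℝ) : Prop :=
  ∃ f : ℝ → ℝ, ∀ᵐ x, u x = f ‖x‖

/-- The integral `∫ V(|x|) |u|² dx`, as an element of `[0, ∞]`, with `∞ · 0 = 0`. -/
def potentialEnergy {N : ℕ} (V : ℝ → ℝ≥0∞) (u : RN N → ℝ) : ℝ≥0∞ :=
  ∫⁻ x, V ‖x‖ * ‖u x‖ₑ ^ 2

/-- `u ∈ H²_{V,r}(ℝ^N)`: radial functions in `D^{2,2}` with `∫ V(|x|) |u|² dx < ⊤`. -/
structure MemHVr {N : ℕ} (V : ℝ → ℝ≥0∞) (u : RN N → ℝ) : Prop where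
  memD22 : MemD22 u
  potentialEnergy_lt_top : potentialEnergy V u < ⊤
  radial : IsRadial u

/-- The norm `‖u‖ = (∫ |Δu|² + V(|x|) |u|² dx)^{1/2}` (finite on `H²_V`). -/
def normHV {N : ℕ} (V : ℝ → ℝ≥0∞) (u : RN N → ℝ) : ℝ≥0∞ :=
  ((∫⁻ x, ‖weakLaplacian u x‖ₑ ^ 2) + potentialEnergy V u) ^ (1 / 2 : ℝ)

/-- `R_∞(q,R)`: the supremum, in `[0, ∞]`, of `∫_{ℝ^N ∖ B_R} K(|x|) |u|^{q-1} |h| dx` over all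
`u, h ∈ H²_{V,r}` with `‖u‖ = ‖h‖ = 1`. -/
def Rinfty (N : ℕ) (V : ℝ → ℝ≥0∞) (K : ℝ → ℝ) (q R : ℝ) : ℝ≥0∞ :=
  ⨆ (u : RN N → ℝ) (h : RN N → ℝ) (_ : MemHVr V u) (_ : MemHVr V h)
    (_ : normHV V u = 1) (_ : normHV V h = 1),
    ∫⁻ x in (Metric.ball (0 : RN N) R)ᶜ, ENNReal.ofReal (K ‖x‖) * ‖u x‖ₑ ^ (q - 1) * ‖h x‖ₑ

/-- Assumption (V): `V : (0,∞) → [0,∞]` is (Lebesgue) measurable and in `L¹_loc((0,∞))`.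
Only the values of `V` on `(0,∞)` matter. -/
structure AssumptionV (V : ℝ → ℝ≥0∞) : Prop where
  aemeasurable : AEMeasurable V (volume.restrict (Ioi 0))
  locallyIntegrable : ∀ S : Set ℝ, IsCompact S → S ⊆ Ioi 0 → ∫⁻ r in S, V r < ⊤

/-- Assumption (K): `K : (0,∞) → (0,∞)` is (Lebesgue) measurable and in `L^s_loc((0,∞))` for
some `s > 1`. Only the values of `K` on `(0,∞)` matter. -/
structure AssumptionK (K : ℝ → ℝ) : Prop where
  pos : ∀ r : ℝ, 0 < r → 0 < K r
  aemeasurable : AEMeasurable K (volume.restrict (Ioi 0))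
  memLp_loc : ∃ s : ℝ, 1 < s ∧ ∀ S : Set ℝ, IsCompact S → S ⊆ Ioi 0 →
    MemLp K (ENNReal.ofReal s) (volume.restrict S)

/-- `q*(α,β) = 2 (α - 4β + N)/(N - 4)`. -/
def qStar (N : ℕ) (α β : ℝ) : ℝ := 2 * ((α - 4 * β + N) / ((N : ℝ) - 4))

end

/-! The engine is a radial decay estimate: `|u(x)| ≤ C ‖Δu‖₂ |x|^((4-N)/2)` almost everywhere for
radial `u` in `D^{2,2}`. It is proved by duality, without smooth approximation of `u`. For a radial
source `ψ` supported in `a ≤ |x| ≤ b` with zero mean, `Δφ = ψ` has an explicit compactly supported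
radial solution bounded by a multiple of `(a + |x|)^(2-N)`. For `N ≥ 5` this is square integrable,
with norm of order `a^((4-N)/2)`, so Cauchy–Schwarz bounds `∫ u ψ = ∫ Δu φ`
(`abs_integral_mul_radial_le_of_mean_zero`). A nonzero mean is carried off to infinity at no cost,
because `u` lies in some `L^p` with `p < ∞` (`abs_integral_mul_radial_le`). Letting `ψ` concentrate
at a radius `t` gives the pointwise bound (`exists_radial_decay_const`).

On the unit sphere, for large `r = |x|`, the hypothesis on `K` and the decay bound `K |u|^q` by a
constant times `(V u²)^β r^(α + (4-N)(q-2β)/2)`. The condition `q > q*` says exactly that this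
exponent lies below `-N(1-β)`. The surplus is shared between a factor `R^(-δ)` and an integrable
weight to the power `1-β`; Hölder and `∫ V u² ≤ 1` finish (`exists_lintegral_compl_ball_le`). The
mixed integrand reduces to this case through `|u|^(q-1)|h| ≤ |u|^q + |h|^q`. -/

/-! ### Null sets of radii -/

theorem quasiMeasurePreserving_norm {N : ℕ} (hN : 1 ≤ N) :
    Measure.QuasiMeasurePreserving (fun x : RN N => ‖x‖) volume (volume.restrict (Ioi 0)) := by
  have : Nonempty (Fin N) := ⟨⟨0, hN⟩⟩
  refine ⟨measurable_norm, Measure.AbsolutelyContinuous.mk fun s hs h0 => ?_⟩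
  rw [Measure.map_apply measurable_norm hs]
  rw [Measure.restrict_apply hs] at h0
  -- In polar coordinates the indicator of a null set of radii integrates to zero over the whole
  -- space.
  set f : ℝ → ℝ := s.indicator 1 with hf
  have hz : (fun y : ℝ => y ^ (Module.finrank ℝ (RN N) - 1) • f y)
      =ᵐ[volume.restrict (Ioi 0)] 0 := by
    have : ∀ᵐ y ∂(volume.restrict (Ioi (0 : ℝ))), y ∉ s := by
      rw [ae_iff]
      simpa [Measure.restrict_apply hs] using h0
    filter_upwards [this] with y hy
    simp [hf, hy]
  have hint : Integrable (fun x : RN N => f ‖x‖) volume := by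
    rw [integrable_fun_norm_addHaar]
    exact (integrable_zero _ _ _).congr hz.symm
  have hI : ∫ x : RN N, f ‖x‖ = 0 := by
    rw [integral_fun_norm_addHaar, integral_congr_ae hz]
    simp
  rw [integral_eq_zero_iff_of_nonneg (fun x => indicator_nonneg (by simp) _) hint] at hI
  refine measure_mono_null ?_ (ae_iff.1 hI)
  intro x hx
  have hx' : ‖x‖ ∈ s := hx
  simp [hx']

/-! ### Calculus of radial functions -/

section CompNorm

variable {E : Type*} [NormedAddCommGroup E] [InnerProductSpace ℝ E]

theorem hasFDerivAt_norm_of_ne_zero {x : E} (hx : x ≠ 0) :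
    HasFDerivAt (fun y : E => ‖y‖) (‖x‖⁻¹ • innerSL ℝ x) x := by
  have h := (hasStrictFDerivAt_norm_sq x).hasFDerivAt.sqrt (by simpa using hx)
  simp only [Real.sqrt_sq (norm_nonneg _)] at h
  refine h.congr_fderiv ?_
  ext y
  have := norm_ne_zero_iff.2 hx
  simp
  field_simp

/-- Constancy near the origin removes the singularity of the norm. At `x = 0` the formula still
holds, since `innerSL ℝ 0 = 0`. -/
theorem hasFDerivAt_comp_norm {F F' : ℝ → ℝ} {a c : ℝ} (ha : 0 < a)
    (hF : ∀ r, HasDerivAt F (F' r) r) (hc : ∀ r ≤ a, F r = c) (x : E) :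
    HasFDerivAt (fun y : E => F ‖y‖) ((F' ‖x‖ * ‖x‖⁻¹) • innerSL ℝ x) x := by
  rcases eq_or_ne x 0 with rfl | hx
  · have h : (fun y : E => F ‖y‖) =ᶠ[𝓝 0] fun _ => c := by
      filter_upwards [Metric.ball_mem_nhds (0 : E) ha] with y hy
      exact hc _ (by simpa using (mem_ball_zero_iff.1 hy).le)
    simpa using (hasFDerivAt_const c (0 : E)).congr_of_eventuallyEq h
  · have := (hF ‖x‖).comp_hasFDerivAt x (hasFDerivAt_norm_of_ne_zero hx)
    rw [smul_smul] at this
    exact this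

theorem contDiff_comp_norm {F : ℝ → ℝ} {a c : ℝ} (ha : 0 < a)
    (hF : ContDiff ℝ ∞ F) (hc : ∀ r ≤ a, F r = c) :
    ContDiff ℝ ∞ (fun y : E => F ‖y‖) := by
  rw [contDiff_iff_contDiffAt]
  intro x
  rcases eq_or_ne x 0 with rfl | hx
  · have h : (fun y : E => F ‖y‖) =ᶠ[𝓝 0] fun _ => c := by
      filter_upwards [Metric.ball_mem_nhds (0 : E) ha] with y hy
      exact hc _ (by simpa using (mem_ball_zero_iff.1 hy).le)
    exact contDiffAt_const.congr_of_eventuallyEq h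
  · exact hF.contDiffAt.comp x (contDiffAt_norm ℝ hx)

/-- With the derivative of `P` written as `r Q`, the gradient is `Q(|x|) x`, free of quotients, and
the product rule applies directly. -/
theorem iteratedFDeriv_two_comp_norm {P Q Q' : ℝ → ℝ} {a c : ℝ} (ha : 0 < a)
    (hP : ∀ r, HasDerivAt P (r * Q r) r) (hPc : ∀ r ≤ a, P r = c)
    (hQ : ∀ r, HasDerivAt Q (Q' r) r) (hQ0 : ∀ r ≤ a, Q r = 0) (x v w : E) :
    iteratedFDeriv ℝ 2 (fun y : E => P ‖y‖) x ![v, w] =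
      Q ‖x‖ * inner ℝ v w + Q' ‖x‖ * ‖x‖⁻¹ * inner ℝ x v * inner ℝ x w := by
  have h1 : fderiv ℝ (fun y : E => P ‖y‖) = fun y => Q ‖y‖ • innerSL ℝ y := by
    ext1 y
    rw [(hasFDerivAt_comp_norm ha hP hPc y).fderiv]
    rcases eq_or_ne y 0 with rfl | hy
    · simp
    · congr 1
      have := norm_ne_zero_iff.2 hy
      field_simp
  have h2 := (hasFDerivAt_comp_norm (E := E) ha hQ hQ0 x).fun_smul
    (innerSL ℝ (E := E)).hasFDerivAt
  rw [iteratedFDeriv_two_apply, h1, h2.fderiv]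
  simp
  rfl

end CompNorm

theorem sum_partial2_comp_norm {N : ℕ} {P Q Q' : ℝ → ℝ} {a c : ℝ} (ha : 0 < a)
    (hP : ∀ r, HasDerivAt P (r * Q r) r) (hPc : ∀ r ≤ a, P r = c)
    (hQ : ∀ r, HasDerivAt Q (Q' r) r) (hQ0 : ∀ r ≤ a, Q r = 0) (x : RN N) :
    ∑ i, partial2 i i (fun y : RN N => P ‖y‖) x = N * Q ‖x‖ + ‖x‖ * Q' ‖x‖ := by
  have key : ∀ i, partial2 i i (fun y : RN N => P ‖y‖) x
      = Q ‖x‖ + Q' ‖x‖ * ‖x‖⁻¹ * (x i) ^ 2 := by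
    intro i
    rw [partial2, iteratedFDeriv_two_comp_norm ha hP hPc hQ hQ0]
    simp [EuclideanSpace.inner_single_right]
    ring
  simp only [key, Finset.sum_add_distrib, ← Finset.mul_sum]
  rw [← EuclideanSpace.real_norm_sq_eq]
  rcases eq_or_ne x 0 with rfl | hx
  · simp
  · have := norm_ne_zero_iff.2 hx
    simp
    field_simp

/-! ### The radial Poisson equation -/

theorem contDiff_intervalIntegral {f : ℝ → ℝ} (hf : ContDiff ℝ ∞ f) (a : ℝ) :
    ContDiff ℝ ∞ (fun r => ∫ s in a..r, f s) := by
  have hd : ∀ r, HasDerivAt (fun r => ∫ s in a..r, f s) (f r) r := fun r =>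
    hf.continuous.integral_hasStrictDerivAt a r |>.hasDerivAt
  rw [contDiff_infty_iff_deriv]
  refine ⟨fun r => (hd r).differentiableAt, ?_⟩
  rw [show deriv (fun r => ∫ s in a..r, f s) = f from funext fun r => (hd r).deriv]
  exact hf

theorem integral_pow_inv_le {k : ℕ} {r b : ℝ} (hr : 0 < r) (hb : r ≤ b) :
    ∫ s in r..b, (s ^ (k + 2))⁻¹ ≤ (r ^ (k + 1))⁻¹ := by
  have hd : ∀ s ∈ uIcc r b,
      HasDerivAt (fun s : ℝ => -((k + 1 : ℝ))⁻¹ * (s ^ (k + 1))⁻¹) ((s ^ (k + 2))⁻¹) s := by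
    intro s hs
    rw [uIcc_of_le hb] at hs
    have hs0 : s ≠ 0 := (hr.trans_le hs.1).ne'
    have h := ((hasDerivAt_pow (k + 1) s).fun_inv (pow_ne_zero _ hs0)).const_mul (-((k + 1 : ℝ))⁻¹)
    convert! h using 1
    have : (k + 1 : ℝ) ≠ 0 := by positivity
    push_cast
    simp
    field_simp
    ring
  have hc : ContinuousOn (fun s : ℝ => (s ^ (k + 2))⁻¹) (uIcc r b) := by
    rw [uIcc_of_le hb]
    exact (continuous_pow _).continuousOn.inv₀ fun s hs => pow_ne_zero _ (hr.trans_le hs.1).ne'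
  rw [intervalIntegral.integral_eq_sub_of_hasDerivAt hd hc.intervalIntegrable]
  have h1 : 0 ≤ (k + 1 : ℝ)⁻¹ * (b ^ (k + 1))⁻¹ := by
    have := hr.trans_le hb
    positivity
  have h2 : (k + 1 : ℝ)⁻¹ * (r ^ (k + 1))⁻¹ ≤ 1 * (r ^ (k + 1))⁻¹ := by
    gcongr
    exact inv_le_one_of_one_le₀ (by simp)
  linarith

/-- A compactly supported radial solution `φ` of `Δ φ = ψ(|x|)`, for a radial source `ψ`
of zero mean vanishing near the origin, and its decay. -/
theorem exists_radial_laplacian_eq {N : ℕ} (hN : 3 ≤ N) {ψ : ℝ → ℝ} (hψ : ContDiff ℝ ∞ ψ)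
    {a b m : ℝ} (ha : 0 < a) (h0 : ∀ r ≤ a, ψ r = 0) (h1 : ∀ r, b ≤ r → ψ r = 0)
    (hmean : ∫ s in a..b, s ^ (N - 1) * ψ s = 0)
    (hm : ∀ r, |∫ s in a..r, s ^ (N - 1) * ψ s| ≤ m) :
    ∃ φ : RN N → ℝ, ContDiff ℝ ∞ φ ∧ HasCompactSupport φ ∧
      (∀ x, ∑ i, partial2 i i φ x = ψ ‖x‖) ∧
      ∀ x, |φ x| ≤ m * 2 ^ (N - 2) * ((a + ‖x‖) ^ (N - 2))⁻¹ := by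
  obtain ⟨k, rfl⟩ : ∃ k, N = k + 3 := ⟨N - 3, by omega⟩
  simp only [show k + 3 - 1 = k + 2 by omega, show k + 3 - 2 = k + 1 by omega] at *
  have hm0 : 0 ≤ m := (abs_nonneg _).trans (hm a)
  set f : ℝ → ℝ := fun s => s ^ (k + 2) * ψ s with hf
  have hfC : ContDiff ℝ ∞ f := (contDiff_id.pow _).mul hψ
  set I : ℝ → ℝ := fun r => ∫ s in a..r, f s with hI
  have hIC : ContDiff ℝ ∞ I := contDiff_intervalIntegral hfC a
  have hId : ∀ r, HasDerivAt I (f r) r := fun r =>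
    (hfC.continuous.integral_hasStrictDerivAt a r).hasDerivAt
  have hI0 : ∀ r ≤ a, I r = 0 := by
    intro r hr
    refine (intervalIntegral.integral_congr (g := fun _ => 0) fun s hs => ?_).trans (by simp)
    rw [uIcc_of_ge hr] at hs
    simp [hf, h0 s hs.2]
  have hI1 : ∀ r, b ≤ r → I r = 0 := by
    intro r hr
    have e : I r = I b + ∫ s in b..r, f s :=
      (intervalIntegral.integral_add_adjacent_intervals
        (hfC.continuous.intervalIntegrable _ _) (hfC.continuous.intervalIntegrable _ _)).symm
    rw [e, show I b = 0 from hmean, zero_add]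
    refine (intervalIntegral.integral_congr (g := fun _ => 0) fun s hs => ?_).trans (by simp)
    rw [uIcc_of_le hr] at hs
    simp [hf, h1 s hs.1]
  -- The radial equation is `(r^(N-1) P')' = r^(N-1) ψ`, so `r^(N-1) P' = I`; as `P' = r Q`, this
  -- forces `Q = I / r^N`, with `N = k + 3`.
  set Q : ℝ → ℝ := fun r => I r / r ^ (k + 3) with hQ
  have hQ0 : ∀ r ≤ a, Q r = 0 := fun r hr => by simp [hQ, hI0 r hr]
  have hQC : ContDiff ℝ ∞ Q := by
    rw [contDiff_iff_contDiffAt]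
    intro r
    rcases lt_or_ge r a with hr | hr
    · have : Q =ᶠ[𝓝 r] fun _ => 0 := by
        filter_upwards [Iio_mem_nhds hr] with s hs using hQ0 s (le_of_lt hs)
      exact contDiffAt_const.congr_of_eventuallyEq this
    · exact hIC.contDiffAt.div (contDiff_id.pow (k + 3) : ContDiff ℝ ∞ fun r : ℝ => r ^ (k + 3)).contDiffAt
        (pow_ne_zero _ (ha.trans_le hr).ne')
  have hgC : ContDiff ℝ ∞ (fun s => s * Q s) := contDiff_id.mul hQC
  -- Beyond `b` the zero mean gives `I = 0`, hence `P' = 0`; the base point `b` makes the constant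
  -- value there zero, which yields compact support.
  set P : ℝ → ℝ := fun r => ∫ s in b..r, s * Q s with hP
  have hPC : ContDiff ℝ ∞ P := contDiff_intervalIntegral hgC b
  have hPd : ∀ r, HasDerivAt P (r * Q r) r := fun r =>
    (hgC.continuous.integral_hasStrictDerivAt b r).hasDerivAt
  have hP0 : ∀ r ≤ a, P r = P a := by
    intro r hr
    have e : P r = P a + ∫ s in a..r, s * Q s :=
      (intervalIntegral.integral_add_adjacent_intervals
        (hgC.continuous.intervalIntegrable _ _) (hgC.continuous.intervalIntegrable _ _)).symm
    rw [e, add_eq_left]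
    refine (intervalIntegral.integral_congr (g := fun _ => 0) fun s hs => ?_).trans (by simp)
    rw [uIcc_of_ge hr] at hs
    simp [hQ0 s hs.2]
  have hP1 : ∀ r, b ≤ r → P r = 0 := by
    intro r hr
    refine (intervalIntegral.integral_congr (g := fun _ => 0) fun s hs => ?_).trans (by simp)
    rw [uIcc_of_le hr] at hs
    simp [hQ, hI1 s hs.1]
  have hQd : ∀ r, HasDerivAt Q (deriv Q r) r := fun r =>
    ((hQC.differentiable (by simp)) r).hasDerivAt
  have hPbd : ∀ r, a ≤ r → |P r| ≤ m * (r ^ (k + 1))⁻¹ := by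
    intro r hr
    have hr0 : 0 < r := ha.trans_le hr
    rcases le_total b r with hbr | hbr
    · rw [hP1 r hbr, abs_zero]
      positivity
    · have h2 : |∫ s in r..b, s * Q s| ≤ ∫ s in r..b, m * (s ^ (k + 2))⁻¹ := by
        rw [← Real.norm_eq_abs]
        refine intervalIntegral.norm_integral_le_of_norm_le hbr ?_ ?_
        · refine Eventually.of_forall fun s hs => ?_
          have hs0 : 0 < s := hr0.trans hs.1
          have e : s * Q s = I s * (s ^ (k + 2))⁻¹ := by
            simp only [hQ]
            field_simp
            ring
          rw [e, norm_mul, Real.norm_eq_abs, Real.norm_of_nonneg (by positivity)]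
          gcongr
          exact hm s
        · refine ContinuousOn.intervalIntegrable ?_
          rw [uIcc_of_le hbr]
          exact continuousOn_const.mul ((continuous_pow _).continuousOn.inv₀ fun s hs =>
            pow_ne_zero _ (hr0.trans_le hs.1).ne')
      rw [intervalIntegral.integral_const_mul] at h2
      simp only [hP]
      rw [intervalIntegral.integral_symm, abs_neg]
      exact h2.trans (mul_le_mul_of_nonneg_left (integral_pow_inv_le hr0 hbr) hm0)
  refine ⟨fun x => P ‖x‖, contDiff_comp_norm ha hPC hP0, ?_, fun x => ?_, fun x => ?_⟩
  · refine HasCompactSupport.intro (isCompact_closedBall (0 : RN (k + 3)) b) fun x hx => hP1 _ ?_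
    simpa using (not_le.1 (fun h => hx (mem_closedBall_zero_iff.2 h))).le
  · rw [sum_partial2_comp_norm ha hPd hP0 hQd hQ0]
    rcases le_or_gt ‖x‖ 0 with hx | hx
    · have hx' : ‖x‖ = 0 := le_antisymm hx (norm_nonneg _)
      rw [hx', h0 0 ha.le, hQ0 0 ha.le]
      simp
    · have hd : HasDerivAt Q _ ‖x‖ :=
        (hId ‖x‖).fun_div (hasDerivAt_pow (k + 3) ‖x‖) (pow_ne_zero _ hx.ne')
      rw [hd.deriv]
      simp only [hQ, hf]
      push_cast
      field_simp
      ring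
  · have hr := norm_nonneg x
    have key : |P ‖x‖| ≤ m * ((max a ‖x‖) ^ (k + 1))⁻¹ := by
      rcases le_total a ‖x‖ with h | h
      · rw [max_eq_right h]
        exact hPbd _ h
      · rw [max_eq_left h, hP0 _ h]
        exact hPbd _ le_rfl
    refine key.trans ?_
    rw [mul_assoc]
    refine mul_le_mul_of_nonneg_left ?_ hm0
    -- The factor `2^(N-2)` comes from `a + |x| ≤ 2 max(a, |x|)`.
    rw [← div_eq_mul_inv, ← inv_div, ← div_pow]
    gcongr
    rcases le_total a ‖x‖ with h | h
    · rw [max_eq_right h]; linarith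
    · rw [max_eq_left h]; linarith

/-! ### Scaling of the decay profile and the duality estimate -/

/-- The squared `L²` norm of `(1 + |x|)^{2-N}`. -/
noncomputable def decayEnergy (N : ℕ) : ℝ := ∫ x : RN N, (((1 + ‖x‖) ^ (N - 2))⁻¹) ^ 2

/-- Integrability needs `2(N-2) > N`, which is `N > 4`. -/
theorem integrable_decay {N : ℕ} (hN : 5 ≤ N) :
    Integrable (fun x : RN N => (((1 + ‖x‖) ^ (N - 2))⁻¹) ^ 2) := by
  have h := integrable_one_add_norm (E := RN N) (μ := volume) (r := ((2 * (N - 2) : ℕ) : ℝ))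
    (by rw [finrank_euclideanSpace_fin]; exact_mod_cast (by omega))
  refine h.congr (Eventually.of_forall fun x => ?_)
  have : 0 < 1 + ‖x‖ := by positivity
  simp only
  rw [Real.rpow_neg this.le, Real.rpow_natCast, mul_comm 2, pow_mul, inv_pow]

theorem scaled_decay {N : ℕ} {a : ℝ} (ha : 0 < a) (x : RN N) :
    (((a + ‖x‖) ^ (N - 2))⁻¹) ^ 2
      = ((a ^ (N - 2))⁻¹) ^ 2 * (((1 + ‖a⁻¹ • x‖) ^ (N - 2))⁻¹) ^ 2 := by
  rw [← mul_pow, ← mul_inv, ← mul_pow]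
  congr 4
  rw [norm_smul, norm_inv, Real.norm_of_nonneg ha.le]
  field_simp

theorem integrable_scaled_decay {N : ℕ} (hN : 5 ≤ N) {a : ℝ} (ha : 0 < a) :
    Integrable (fun x : RN N => (((a + ‖x‖) ^ (N - 2))⁻¹) ^ 2) := by
  simp only [scaled_decay ha]
  exact ((integrable_decay hN).comp_smul (inv_ne_zero ha.ne')).const_mul _

/-- Substituting `x = a y` produces the power `-2(N-2) + N = 4 - N`. Its half is the exponent of the
radial decay. -/
theorem integral_scaled_decay {N : ℕ} (hN : 5 ≤ N) {a : ℝ} (ha : 0 < a) :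
    ∫ x : RN N, (((a + ‖x‖) ^ (N - 2))⁻¹) ^ 2 = (a ^ (((4 : ℝ) - N) / 2)) ^ 2 * decayEnergy N := by
  simp only [scaled_decay ha]
  rw [integral_const_mul,
    Measure.integral_comp_inv_smul_of_nonneg (μ := (volume : Measure (RN N)))
      (fun y => (((1 + ‖y‖) ^ (N - 2))⁻¹) ^ 2) ha.le,
    finrank_euclideanSpace_fin, smul_eq_mul, ← mul_assoc, decayEnergy]
  congr 1
  rw [← Real.rpow_natCast (a ^ (((4 : ℝ) - N) / 2)) 2, ← Real.rpow_mul ha.le, inv_pow, ← pow_mul,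
    ← Real.rpow_natCast a ((N - 2) * 2), ← Real.rpow_neg ha.le, ← Real.rpow_natCast a N,
    ← Real.rpow_add ha, Nat.cast_mul, Nat.cast_sub (by omega)]
  congr 1
  push_cast
  ring

/-- The constant in the radial decay estimate. -/
noncomputable def radialConst (N : ℕ) : ℝ := 2 ^ (N - 2) * Real.sqrt (decayEnergy N)

theorem radialConst_nonneg (N : ℕ) : 0 ≤ radialConst N := by
  unfold radialConst; positivity

theorem abs_integral_mul_le_sqrt {α : Type*} [MeasurableSpace α] {μ : Measure α} {f g : α → ℝ}
    (hf : MemLp f 2 μ) (hg : MemLp g 2 μ) :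
    |∫ x, f x * g x ∂μ| ≤ Real.sqrt (∫ x, f x ^ 2 ∂μ) * Real.sqrt (∫ x, g x ^ 2 ∂μ) := by
  refine (abs_integral_le_integral_abs).trans ?_
  have h := integral_mul_norm_le_Lp_mul_Lq (μ := μ) (f := f) (g := g) Real.HolderConjugate.two_two
    (by simpa using hf) (by simpa using hg)
  simpa [abs_mul, Real.sqrt_eq_rpow] using h

theorem abs_integral_mul_radial_le_of_mean_zero {N : ℕ} (hN : 5 ≤ N) {u g : RN N → ℝ}
    (hg : MemLp g 2 volume)
    (hug : ∀ φ : RN N → ℝ, ContDiff ℝ ∞ φ → HasCompactSupport φ →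
      ∫ x, u x * ∑ i, partial2 i i φ x = ∫ x, g x * φ x)
    {ψ : ℝ → ℝ} (hψ : ContDiff ℝ ∞ ψ)
    {a b m : ℝ} (ha : 0 < a) (h0 : ∀ r ≤ a, ψ r = 0) (h1 : ∀ r, b ≤ r → ψ r = 0)
    (hmean : ∫ s in a..b, s ^ (N - 1) * ψ s = 0)
    (hm : ∀ r, |∫ s in a..r, s ^ (N - 1) * ψ s| ≤ m) :
    |∫ x, u x * ψ ‖x‖|
      ≤ m * a ^ (((4 : ℝ) - N) / 2) * (radialConst N * Real.sqrt (∫ x, g x ^ 2)) := by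
  have hm0 : 0 ≤ m := (abs_nonneg _).trans (hm a)
  obtain ⟨φ, hφ, hφc, hΔ, hbd⟩ :=
    exists_radial_laplacian_eq (N := N) (by omega) hψ ha h0 h1 hmean hm
  have e := hug φ hφ hφc
  simp only [hΔ] at e
  rw [e]
  have hφ2 : MemLp φ 2 volume := hφ.continuous.memLp_of_hasCompactSupport hφc
  refine (abs_integral_mul_le_sqrt hg hφ2).trans ?_
  have h2 : ∫ x, φ x ^ 2 ≤ (m * a ^ (((4 : ℝ) - N) / 2) * radialConst N) ^ 2 := by
    calc ∫ x, φ x ^ 2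
        ≤ ∫ x : RN N, (m * 2 ^ (N - 2)) ^ 2 * (((a + ‖x‖) ^ (N - 2))⁻¹) ^ 2 := by
          refine integral_mono hφ2.integrable_sq ((integrable_scaled_decay hN ha).const_mul _)
            fun x => ?_
          simp only
          rw [← mul_pow, ← sq_abs]
          exact pow_le_pow_left₀ (abs_nonneg _) (hbd x) 2
      _ = _ := by
          rw [integral_const_mul, integral_scaled_decay hN ha, radialConst]
          have h3 : 0 ≤ decayEnergy N := integral_nonneg fun x => by positivity
          have h4 := Real.sq_sqrt h3
          linear_combination (-(m * 2 ^ (N - 2) * a ^ (((4 : ℝ) - N) / 2)) ^ 2) * h4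
  have h3 : Real.sqrt (∫ x, φ x ^ 2) ≤ m * a ^ (((4 : ℝ) - N) / 2) * radialConst N :=
    Real.sqrt_le_iff.2 ⟨by have := radialConst_nonneg N; positivity, h2⟩
  calc _ ≤ Real.sqrt (∫ x, g x ^ 2) * (m * a ^ (((4 : ℝ) - N) / 2) * radialConst N) := by gcongr
    _ = _ := by ring

/-! ### Removing the zero-mean condition -/

/-- Hölder on the ball bounds the average by a multiple of `R^(-N/p)`; finiteness of `p` is what
makes it vanish. -/
theorem tendsto_scaled_integral_closedBall {N : ℕ} (hN : 1 ≤ N) {u : RN N → ℝ} {p : ℝ≥0∞}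
    (hp1 : 1 ≤ p) (hp : p ≠ ⊤) (hu : MemLp u p volume) :
    Tendsto (fun R : ℝ => (R ^ N)⁻¹ * ∫ x in Metric.closedBall 0 R, |u x|) atTop (𝓝 0) := by
  set θ : ℝ := 1 / p.toReal with hθ
  have hpt : 0 < p.toReal := ENNReal.toReal_pos (zero_lt_one.trans_le hp1).ne' hp
  have hθ0 : 0 < θ := by positivity
  have hθ1 : 0 ≤ 1 - θ := by
    have : 1 ≤ p.toReal := by simpa using (ENNReal.toReal_le_toReal ENNReal.one_ne_top hp).2 hp1
    rw [sub_nonneg, hθ, div_le_one hpt]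
    exact this
  set A : ℝ := (eLpNorm u p volume).toReal * (volume (Metric.closedBall (0 : RN N) 1)).toReal ^ (1 - θ)
  have hlim : Tendsto (fun R : ℝ => A * R ^ (-(N * θ))) atTop (𝓝 0) := by
    have : 0 < N * θ := by
      have : (0 : ℝ) < N := by exact_mod_cast hN
      positivity
    simpa using (tendsto_rpow_neg_atTop this).const_mul A
  refine squeeze_zero' ?_ ?_ hlim
  · filter_upwards [eventually_ge_atTop 0] with R hR
    have : 0 ≤ ∫ x in Metric.closedBall (0 : RN N) R, |u x| := integral_nonneg fun x => abs_nonneg _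
    positivity
  · filter_upwards [eventually_gt_atTop 0] with R hR
    set S := Metric.closedBall (0 : RN N) R
    have hS : volume S ≠ ⊤ := measure_closedBall_lt_top.ne
    have h1 : ∫ x in S, |u x| = (eLpNorm u 1 (volume.restrict S)).toReal := by
      rw [eLpNorm_one_eq_lintegral_enorm]
      exact integral_norm_eq_lintegral_enorm hu.aestronglyMeasurable.restrict
    have h2 : eLpNorm u 1 (volume.restrict S) ≤ eLpNorm u p volume * volume S ^ (1 - θ) := by
      have := eLpNorm_le_eLpNorm_mul_rpow_measure_univ hp1
        (hu.aestronglyMeasurable.restrict (s := S))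
      rw [Measure.restrict_apply_univ, ENNReal.toReal_one, div_one] at this
      exact this.trans (by gcongr; exact Measure.restrict_le_self)
    have h3 : ∫ x in S, |u x| ≤ A * (R ^ N) ^ (1 - θ) := by
      rw [h1]
      refine (ENNReal.toReal_mono (ENNReal.mul_ne_top hu.eLpNorm_ne_top
        (ENNReal.rpow_ne_top_of_nonneg hθ1 hS)) h2).trans ?_
      rw [ENNReal.toReal_mul, ← ENNReal.toReal_rpow,
        Measure.addHaar_closedBall' _ _ hR.le, ENNReal.toReal_mul, ENNReal.toReal_ofReal (by positivity),
        Real.mul_rpow (by positivity) (by positivity), finrank_euclideanSpace_fin]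
      simp only [A]
      exact le_of_eq (by ring)
    have e : R ^ (-(N * θ)) = (R ^ N)⁻¹ * (R ^ N) ^ (1 - θ) := by
      rw [← Real.rpow_natCast, ← Real.rpow_neg hR.le, ← Real.rpow_mul hR.le, ← Real.rpow_add hR]
      congr 1
      ring
    rw [e]
    calc (R ^ N)⁻¹ * ∫ x in S, |u x| ≤ (R ^ N)⁻¹ * (A * (R ^ N) ^ (1 - θ)) := by gcongr
      _ = _ := by ring

theorem integrable_of_vanishing {f : ℝ → ℝ} (hf : Continuous f) {a b : ℝ}
    (h0 : ∀ s ≤ a, f s = 0) (h1 : ∀ s, b ≤ s → f s = 0) : Integrable f := by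
  refine hf.integrable_of_hasCompactSupport (HasCompactSupport.intro (isCompact_Icc (a := a) (b := b))
    fun s hs => ?_)
  rcases le_or_gt s a with h | h
  · exact h0 s h
  · rcases le_or_gt b s with h' | h'
    · exact h1 s h'
    · exact absurd ⟨h.le, h'.le⟩ hs

theorem intervalIntegral_mem_Icc_of_vanishing {f : ℝ → ℝ} (hf : Continuous f) (hpos : ∀ s, 0 ≤ f s)
    {a b : ℝ} (h0 : ∀ s ≤ a, f s = 0) (h1 : ∀ s, b ≤ s → f s = 0) (r : ℝ) :
    ∫ s in a..r, f s ∈ Icc 0 (∫ s, f s) := by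
  rcases le_total r a with hr | hr
  · have : ∫ s in a..r, f s = 0 := by
      refine (intervalIntegral.integral_congr (g := fun _ => 0) fun s hs => ?_).trans (by simp)
      rw [uIcc_of_ge hr] at hs
      exact h0 s hs.2
    rw [this]
    exact ⟨le_rfl, integral_nonneg hpos⟩
  · rw [intervalIntegral.integral_of_le hr]
    exact ⟨integral_nonneg hpos, setIntegral_le_integral (integrable_of_vanishing hf h0 h1)
      (Eventually.of_forall hpos)⟩

theorem intervalIntegral_eq_integral_of_vanishing {f : ℝ → ℝ} {a b : ℝ}
    (h0 : ∀ s ≤ a, f s = 0) (h1 : ∀ s, b ≤ s → f s = 0) :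
    ∫ s in a..b, f s = ∫ s, f s := by
  refine intervalIntegral.integral_eq_integral_of_support_subset fun s hs => ⟨?_, ?_⟩
  · exact not_le.1 fun h => hs (h0 s h)
  · exact (not_le.1 fun h => hs (h1 s h)).le

theorem exists_radial_mollifier (k : ℕ) :
    ∃ η : ℝ → ℝ, ContDiff ℝ ∞ η ∧ (∀ r, 0 ≤ η r) ∧ (∀ r ≤ 1 / 2, η r = 0) ∧
      (∀ r, 1 ≤ r → η r = 0) ∧ ∫ s, s ^ k * η s = 1 := by
  let B : ContDiffBump (3 / 4 : ℝ) := ⟨1 / 8, 1 / 4, by norm_num, by norm_num⟩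
  have hB0 : ∀ r ≤ 1 / 2, B r = 0 := fun r hr => B.zero_of_le_dist (by
    rw [Real.dist_eq, abs_sub_comm]
    exact le_trans (by show (1 / 4 : ℝ) ≤ 3 / 4 - r; linarith) (le_abs_self _))
  have hB1 : ∀ r, 1 ≤ r → B r = 0 := fun r hr => B.zero_of_le_dist (by
    rw [Real.dist_eq]
    exact le_trans (by show (1 / 4 : ℝ) ≤ r - 3 / 4; linarith) (le_abs_self _))
  have hc : Continuous (fun s : ℝ => s ^ k * B s) := (continuous_pow k).mul B.continuous
  have hnn : ∀ s : ℝ, 0 ≤ s ^ k * B s := fun s => by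
    rcases le_or_gt s (1 / 2) with h | h
    · simp [hB0 s h]
    · have : 0 < s := by linarith
      have := B.nonneg' s
      positivity
  have hpos : 0 < ∫ s : ℝ, s ^ k * B s := by
    refine hc.integral_pos_of_hasCompactSupport_nonneg_nonzero ?_ hnn (x := 3 / 4) ?_
    · exact B.hasCompactSupport.mul_left
    · have : B (3 / 4) = 1 := B.one_of_mem_closedBall (by simp [B])
      rw [this]
      positivity
  refine ⟨fun s => (∫ s : ℝ, s ^ k * B s)⁻¹ * B s, contDiff_const.mul B.contDiff, ?_, ?_, ?_, ?_⟩
  · intro r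
    have := B.nonneg' r
    positivity
  · intro r hr; simp [hB0 r hr]
  · intro r hr; simp [hB1 r hr]
  · set c := ∫ s : ℝ, s ^ k * B s
    have e : ∀ s : ℝ, s ^ k * (c⁻¹ * B s) = c⁻¹ * (s ^ k * B s) := fun s => mul_left_comm _ _ _
    simp only [e]
    rw [integral_const_mul, inv_mul_cancel₀ hpos.ne']

theorem integrable_mul_radial {N : ℕ} {u : RN N → ℝ} (hu : LocallyIntegrable u volume) {ψ : ℝ → ℝ}
    (hψ : Continuous ψ) {b : ℝ} (h1 : ∀ r, b ≤ r → ψ r = 0) :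
    Integrable (fun x => u x * ψ ‖x‖) := by
  have hc : Continuous (fun x : RN N => ψ ‖x‖) := hψ.comp continuous_norm
  have hs : HasCompactSupport (fun x : RN N => ψ ‖x‖) :=
    HasCompactSupport.intro (isCompact_closedBall (0 : RN N) b) fun x hx => h1 _ (by
      simpa using (not_le.1 (fun h => hx (mem_closedBall_zero_iff.2 h))).le)
  simpa [mul_comm] using hu.integrable_smul_left_of_hasCompactSupport hc hs

theorem tendsto_integral_mul_scaled_radial {N : ℕ} (hN : 1 ≤ N) {u : RN N → ℝ} {p : ℝ≥0∞}
    (hp1 : 1 ≤ p) (hp : p ≠ ⊤) (hu : MemLp u p volume) {η : ℝ → ℝ} (hη : Continuous η)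
    (h0 : ∀ r ≤ 1 / 2, η r = 0) (h1 : ∀ r, 1 ≤ r → η r = 0) :
    Tendsto (fun R : ℝ => ∫ x, u x * ((R ^ N)⁻¹ * η (R⁻¹ * ‖x‖))) atTop (𝓝 0) := by
  obtain ⟨M, hM⟩ : ∃ M, ∀ r, ‖η r‖ ≤ M :=
    (HasCompactSupport.intro (isCompact_Icc (a := 1 / 2) (b := (1 : ℝ))) fun s hs => by
      rcases le_or_gt s (1 / 2) with h | h
      · exact h0 s h
      · exact h1 s (le_of_not_ge fun h' => hs ⟨h.le, h'⟩)).exists_bound_of_continuous hη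
  have hl := (tendsto_scaled_integral_closedBall hN hp1 hp hu).const_mul M
  rw [mul_zero] at hl
  refine squeeze_zero_norm' ?_ hl
  filter_upwards [eventually_gt_atTop 0] with R hR
  set S := Metric.closedBall (0 : RN N) R
  have hz : ∀ x, x ∉ S → u x * ((R ^ N)⁻¹ * η (R⁻¹ * ‖x‖)) = 0 := by
    intro x hx
    have hx' : R < ‖x‖ := by simpa [S] using hx
    rw [h1 (R⁻¹ * ‖x‖)]
    · simp
    · rw [← div_eq_inv_mul, one_le_div hR]
      exact hx'.le
  rw [← setIntegral_eq_integral_of_forall_compl_eq_zero hz]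
  have hui : IntegrableOn u S := by
    have : IsFiniteMeasure (volume.restrict S) :=
      ⟨by rw [Measure.restrict_apply_univ]; exact measure_closedBall_lt_top⟩
    exact (hu.restrict S).integrable hp1
  have hle : ‖∫ x in S, u x * ((R ^ N)⁻¹ * η (R⁻¹ * ‖x‖))‖
      ≤ ∫ x in S, M * ((R ^ N)⁻¹ * |u x|) := by
    refine norm_integral_le_of_norm_le ((hui.abs.const_mul _).const_mul _)
      (Eventually.of_forall fun x => ?_)
    rw [norm_mul, norm_mul, Real.norm_of_nonneg (by positivity : (0:ℝ) ≤ (R ^ N)⁻¹), Real.norm_eq_abs]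
    calc |u x| * ((R ^ N)⁻¹ * ‖η (R⁻¹ * ‖x‖)‖) ≤ |u x| * ((R ^ N)⁻¹ * M) := by gcongr; exact hM _
      _ = _ := by ring
  rwa [integral_const_mul, integral_const_mul] at hle

/-- Subtracting from `ψ` its radial mass `m` times a unit-mass profile at scale `R` gives zero mean.
The zero-mean bound is uniform in `R`, and the correction disappears as `R → ∞`. -/
theorem abs_integral_mul_radial_le {N : ℕ} (hN : 5 ≤ N) {u g : RN N → ℝ}
    (hul : LocallyIntegrable u volume) {p : ℝ≥0∞} (hp1 : 1 ≤ p) (hp : p ≠ ⊤)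
    (hu : MemLp u p volume) (hg : MemLp g 2 volume)
    (hug : ∀ φ : RN N → ℝ, ContDiff ℝ ∞ φ → HasCompactSupport φ →
      ∫ x, u x * ∑ i, partial2 i i φ x = ∫ x, g x * φ x)
    {ψ : ℝ → ℝ} (hψ : ContDiff ℝ ∞ ψ) (hψ0 : ∀ r, 0 ≤ ψ r)
    {a b : ℝ} (ha : 0 < a) (h0 : ∀ r ≤ a, ψ r = 0) (h1 : ∀ r, b ≤ r → ψ r = 0) :
    |∫ x, u x * ψ ‖x‖| ≤ (∫ s, s ^ (N - 1) * ψ s) * a ^ (((4 : ℝ) - N) / 2) *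
      (radialConst N * Real.sqrt (∫ x, g x ^ 2)) := by
  obtain ⟨η, hη, hηnn, hη0, hη1, hηI⟩ := exists_radial_mollifier (N - 1)
  set m := ∫ s, s ^ (N - 1) * ψ s with hm
  have hlim : Tendsto (fun R : ℝ => |(∫ x, u x * ψ ‖x‖) -
      m * ∫ x, u x * ((R ^ N)⁻¹ * η (R⁻¹ * ‖x‖))|) atTop (𝓝 |∫ x, u x * ψ ‖x‖|) := by
    have := (tendsto_integral_mul_scaled_radial (by omega) hp1 hp hu hη.continuous hη0 hη1).const_mul m
    simpa using (this.const_sub (∫ x, u x * ψ ‖x‖)).abs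
  refine le_of_tendsto hlim ?_
  filter_upwards [eventually_ge_atTop (2 * a), eventually_ge_atTop b] with R hRa hRb
  have hR : 0 < R := by linarith
  set ζ : ℝ → ℝ := fun r => (R ^ N)⁻¹ * η (R⁻¹ * r) with hζ
  have hζC : ContDiff ℝ ∞ ζ := contDiff_const.mul (hη.comp (contDiff_const.mul contDiff_id))
  have hζ0 : ∀ r ≤ a, ζ r = 0 := fun r hr => by
    simp only [hζ]
    rw [hη0, mul_zero]
    rw [← div_eq_inv_mul, div_le_iff₀ hR]
    linarith
  have hζ1 : ∀ r, R ≤ r → ζ r = 0 := fun r hr => by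
    simp only [hζ]
    rw [hη1, mul_zero]
    rw [← div_eq_inv_mul, one_le_div hR]
    exact hr
  have hζnn : ∀ r, 0 ≤ ζ r := fun r => by
    have := hηnn (R⁻¹ * r)
    simp only [hζ]
    positivity
  have hζI : ∫ s, s ^ (N - 1) * ζ s = 1 := by
    have e : ∀ s : ℝ, s ^ (N - 1) * ζ s = R⁻¹ * ((R⁻¹ * s) ^ (N - 1) * η (R⁻¹ * s)) := by
      intro s
      obtain ⟨k, rfl⟩ : ∃ k, N = k + 1 := ⟨N - 1, by omega⟩
      simp only [hζ, Nat.add_sub_cancel, mul_pow, inv_pow]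
      field_simp
      ring
    simp only [e]
    rw [integral_const_mul, Measure.integral_comp_mul_left (fun s => s ^ (N - 1) * η s) R⁻¹, hηI,
      inv_inv, abs_of_pos hR, smul_eq_mul, mul_one, inv_mul_cancel₀ hR.ne']
  have hψc : Continuous fun s : ℝ => s ^ (N - 1) * ψ s := (continuous_pow _).mul hψ.continuous
  have hζc : Continuous fun s : ℝ => s ^ (N - 1) * ζ s := (continuous_pow _).mul hζC.continuous
  have hw : ∀ {χ : ℝ → ℝ}, (∀ r, 0 ≤ χ r) → (∀ r ≤ a, χ r = 0) → ∀ s, 0 ≤ s ^ (N - 1) * χ s := by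
    intro χ hχ hχ0 s
    rcases le_or_gt s a with h | h
    · simp [hχ0 s h]
    · have := hχ s
      have : 0 < s := ha.trans h
      positivity
  have hA := intervalIntegral_mem_Icc_of_vanishing hψc (hw hψ0 h0) (a := a) (b := R)
    (fun s hs => by simp [h0 s hs]) (fun s hs => by simp [h1 s (hRb.trans hs)])
  have hB := intervalIntegral_mem_Icc_of_vanishing hζc (hw hζnn hζ0) (a := a) (b := R)
    (fun s hs => by simp [hζ0 s hs]) (fun s hs => by simp [hζ1 s hs])
  rw [hζI] at hB
  have hm0 : 0 ≤ m := integral_nonneg (hw hψ0 h0)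
  have hI : ∀ r, ∫ s in a..r, s ^ (N - 1) * (ψ s - m * ζ s)
      = (∫ s in a..r, s ^ (N - 1) * ψ s) - m * ∫ s in a..r, s ^ (N - 1) * ζ s := by
    intro r
    rw [← intervalIntegral.integral_const_mul, ← intervalIntegral.integral_sub
      (hψc.intervalIntegrable _ _) ((show Continuous fun s => m * (s ^ (N - 1) * ζ s) from
        continuous_const.mul hζc).intervalIntegrable _ _)]
    congr 1
    ext s
    ring
  have key := abs_integral_mul_radial_le_of_mean_zero hN hg hug (ψ := fun s => ψ s - m * ζ s)
    (hψ.sub (contDiff_const.mul hζC)) (a := a) (b := R) (m := m) ha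
    (fun r hr => by simp [h0 r hr, hζ0 r hr])
    (fun r hr => by simp [h1 r (hRb.trans hr), hζ1 r hr])
    (by
      rw [hI, intervalIntegral_eq_integral_of_vanishing
        (fun s hs => by simp [h0 s hs]) (fun s hs => by simp [h1 s (hRb.trans hs)]),
        intervalIntegral_eq_integral_of_vanishing
        (fun s hs => by simp [hζ0 s hs]) (fun s hs => by simp [hζ1 s hs]), hζI, ← hm]
      ring)
    -- Both partial masses lie in `[0, m]`, so their difference is at most `m` in absolute value:
    -- the correction does not worsen the constant.
    (fun r => by
      rw [hI, abs_le]
      have h2 := hA r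
      have h3 := hB r
      have h4 := mul_nonneg hm0 h3.1
      have h5 := mul_le_mul_of_nonneg_left h3.2 hm0
      constructor <;> linarith [h2.1, h2.2])
  convert! key using 2
  rw [← integral_const_mul, ← integral_sub (integrable_mul_radial hul hψ.continuous h1)
    ((integrable_mul_radial hul hζC.continuous hζ1).const_mul m)]
  congr 1
  ext x
  ring

/-! ### Pointwise radial decay -/

theorem exists_radial_decay_const {N : ℕ} (hN : 5 ≤ N) : ∃ C : ℝ, 0 ≤ C ∧
    ∀ (u g : RN N → ℝ) (p : ℝ≥0∞), LocallyIntegrable u volume → 1 ≤ p → p ≠ ⊤ →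
      MemLp u p volume → MemLp g 2 volume →
      (∀ φ : RN N → ℝ, ContDiff ℝ ∞ φ → HasCompactSupport φ →
        ∫ x, u x * ∑ i, partial2 i i φ x = ∫ x, g x * φ x) →
      IsRadial u →
      ∀ᵐ x, |u x| ≤ C * Real.sqrt (∫ x, g x ^ 2) * ‖x‖ ^ (((4 : ℝ) - N) / 2) := by
  have hne : Nonempty (Fin N) := ⟨⟨0, by omega⟩⟩
  -- The area of the unit sphere, the constant of polar integration.
  set c : ℝ := N * (volume : Measure (RN N)).real (Metric.ball 0 1) with hc
  have hc0 : 0 < c := by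
    have : 0 < (volume : Measure (RN N)).real (Metric.ball 0 1) :=
      ENNReal.toReal_pos (Metric.measure_ball_pos _ _ one_pos).ne' measure_ball_lt_top.ne
    have : (0 : ℝ) < N := by exact_mod_cast (by omega)
    positivity
  have hrc := radialConst_nonneg N
  -- The test profile at radius `t` lives in `[t/2, 3t/2]`: `3/2` bounds its radial mass and `1/2`
  -- comes from taking `a = t/2`.
  refine ⟨c⁻¹ * (3 / 2) ^ (N - 1) * (1 / 2) ^ (((4 : ℝ) - N) / 2) * radialConst N, by positivity, ?_⟩
  intro u g p hul hp1 hp hu hg hug ⟨f, hf⟩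
  set G := Real.sqrt (∫ x, g x ^ 2)
  set w : ℝ → ℝ := (Ioi 0).indicator fun r => r ^ (N - 1) * f r with hw
  have hwl : LocallyIntegrable w volume := by
    have h1 : ∀ R : ℝ, IntegrableOn (fun y => y ^ (N - 1) * f y) (Ioo 0 R) := by
      intro R
      have h2 : IntegrableOn (fun x : RN N => f ‖x‖) (Metric.ball 0 R) :=
        ((hul.integrableOn_isCompact (isCompact_closedBall 0 R)).mono_set
          Metric.ball_subset_closedBall).congr (ae_restrict_of_ae hf)
      rw [integrableOn_fun_norm_addHaar, finrank_euclideanSpace_fin] at h2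
      exact h2
    intro t
    refine ⟨Ioo (t - 1) (|t| + 1), Ioo_mem_nhds (by linarith) (by linarith [le_abs_self t]), ?_⟩
    rw [hw, integrableOn_indicator_iff measurableSet_Ioi]
    exact (h1 (|t| + 1)).mono_set fun s hs => ⟨hs.1, hs.2.2⟩
  -- The fixed ratio 2 of outer to inner radius is what allows almost everywhere convergence of the
  -- convolutions with a merely locally integrable `w`.
  let φ : ℕ → ContDiffBump (0 : ℝ) := fun n =>
    ⟨1 / ((n : ℝ) + 1) / 2, 1 / ((n : ℝ) + 1), by positivity, half_lt_self (by positivity)⟩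
  have hφ0 : Tendsto (fun n => (φ n).rOut) atTop (𝓝 0) := tendsto_one_div_add_atTop_nhds_zero_nat
  have hconv := ContDiffBump.ae_convolution_tendsto_right_of_locallyIntegrable (μ := volume)
    (K := 2) hφ0 (Eventually.of_forall fun n => by
      show 1 / ((n : ℝ) + 1) ≤ 2 * (1 / ((n : ℝ) + 1) / 2)
      linarith) hwl
  have main : ∀ᵐ t ∂(volume.restrict (Ioi (0 : ℝ))),
      |f t| ≤ c⁻¹ * (3 / 2) ^ (N - 1) * (1 / 2) ^ (((4 : ℝ) - N) / 2) * radialConst N * G *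
        t ^ (((4 : ℝ) - N) / 2) := by
    filter_upwards [ae_restrict_of_ae hconv, ae_restrict_mem measurableSet_Ioi] with t ht ht0
    have ht0 : 0 < t := ht0
    have hlim := ht.abs
    have hwt : w t = t ^ (N - 1) * f t := indicator_of_mem ht0 _
    rw [hwt, abs_mul, abs_of_pos (by positivity)] at hlim
    have hle : t ^ (N - 1) * |f t| ≤
        c⁻¹ * ((3 / 2 * t) ^ (N - 1) * (t / 2) ^ (((4 : ℝ) - N) / 2) * (radialConst N * G)) := by
      refine le_of_tendsto hlim ?_
      filter_upwards [hφ0.eventually (gt_mem_nhds (half_pos ht0))] with n hn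
      -- With this reflected bump, `∫ u ψ(|x|)` is `c` times the convolution of the bump with `w` at
      -- `t`.
      set ψ : ℝ → ℝ := fun r => (φ n).normed volume (t - r) with hψ
      have hψC : ContDiff ℝ ∞ ψ :=
        (ContDiffBump.contDiff_normed (n := ⊤) (φ n)).comp (contDiff_const.sub contDiff_id)
      have hψnn : ∀ r, 0 ≤ ψ r := fun r => (φ n).nonneg_normed _
      have hψz : ∀ r, t / 2 ≤ |t - r| → ψ r = 0 := by
        intro r hr
        by_contra hne
        have : t - r ∈ Function.support ((φ n).normed volume) := hne
        rw [ContDiffBump.support_normed_eq, mem_ball_zero_iff, Real.norm_eq_abs] at this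
        linarith
      have hψ0 : ∀ r ≤ t / 2, ψ r = 0 := fun r hr =>
        hψz r (le_trans (by linarith) (le_abs_self _))
      have hψ1 : ∀ r, 3 / 2 * t ≤ r → ψ r = 0 := fun r hr =>
        hψz r (le_trans (by linarith) (neg_le_abs _))
      have hψI : ∫ s, ψ s = 1 := by
        rw [hψ, integral_sub_left_eq_self]
        exact (φ n).integral_normed
      have hm : ∫ s, s ^ (N - 1) * ψ s ≤ (3 / 2 * t) ^ (N - 1) := by
        calc ∫ s, s ^ (N - 1) * ψ s ≤ ∫ s, (3 / 2 * t) ^ (N - 1) * ψ s := by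
              refine integral_mono (integrable_of_vanishing
                ((continuous_pow _).mul hψC.continuous) (a := t / 2) (b := 3 / 2 * t)
                (fun s hs => by simp [hψ0 s hs]) (fun s hs => by simp [hψ1 s hs]))
                ((integrable_of_vanishing hψC.continuous hψ0 hψ1).const_mul _) fun s => ?_
              simp only
              rcases le_or_gt s (t / 2) with h | h
              · simp [hψ0 s h]
              · rcases le_or_gt (3 / 2 * t) s with h' | h'
                · simp [hψ1 s h']
                · have : 0 ≤ s := by linarith
                  have := hψnn s
                  gcongr
          _ = _ := by rw [integral_const_mul, hψI, mul_one]
      have hcv : ∫ x, u x * ψ ‖x‖ =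
          c * (MeasureTheory.convolution ((φ n).normed volume) w
            (ContinuousLinearMap.lsmul ℝ ℝ) volume) t := by
        have e1 : ∫ x, u x * ψ ‖x‖ = ∫ x : RN N, (fun r => f r * ψ r) ‖x‖ := by
          refine integral_congr_ae ?_
          filter_upwards [hf] with x hx
          rw [hx]
        rw [e1, integral_fun_norm_addHaar volume (fun r => f r * ψ r), finrank_euclideanSpace_fin, convolution_eq_swap,
          nsmul_eq_mul, smul_eq_mul, ← mul_assoc, ← hc, ← integral_indicator measurableSet_Ioi]
        congr 2
        ext s
        by_cases hs : s ∈ Ioi (0 : ℝ)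
        · simp [hw, hs, hψ, indicator_of_mem]
          ring
        · simp [hw, hs]
      have hb := abs_integral_mul_radial_le hN hul hp1 hp hu hg hug hψC hψnn (half_pos ht0) hψ0 hψ1
      rw [hcv, abs_mul, abs_of_pos hc0] at hb
      rw [le_inv_mul_iff₀ hc0]
      refine hb.trans ?_
      have hG : 0 ≤ G := Real.sqrt_nonneg _
      gcongr
    have htp : 0 < t ^ (N - 1) := by positivity
    refine le_of_mul_le_mul_left (hle.trans (le_of_eq ?_)) htp
    rw [mul_pow, show t / 2 = t * (1 / 2) by ring, Real.mul_rpow ht0.le (by norm_num)]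
    ring
  have hx := (quasiMeasurePreserving_norm (N := N) (by omega)).ae main
  filter_upwards [hf, hx] with x h1 h2
  rw [h1]
  exact h2

/-! ### The weak Laplacian and decay on the unit sphere -/

theorem isWeakPartial2_weakPartial2 {N : ℕ} {i j : Fin N} {u : RN N → ℝ}
    (h : ∃ g, IsWeakPartial2 i j u g) : IsWeakPartial2 i j u (weakPartial2 i j u) := by
  rw [weakPartial2, dif_pos h]
  exact h.choose_spec

theorem MemD22.isWeakPartial2 {N : ℕ} {u : RN N → ℝ} (hu : MemD22 u) (i j : Fin N) :
    IsWeakPartial2 i j u (weakPartial2 i j u) := by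
  obtain ⟨g, hg, -⟩ := hu.memLp_deriv i j
  exact isWeakPartial2_weakPartial2 ⟨g, hg⟩

/-- `weakPartial2` is an arbitrary choice; uniqueness up to null sets transfers square integrability
to it. -/
theorem MemD22.memLp_weakPartial2 {N : ℕ} {u : RN N → ℝ} (hu : MemD22 u) (i j : Fin N) :
    MemLp (weakPartial2 i j u) 2 volume := by
  obtain ⟨g, hg, hg2⟩ := hu.memLp_deriv i j
  exact (memLp_congr_ae (hg.ae_eq (hu.isWeakPartial2 i j))).1 hg2

theorem MemD22.memLp_weakLaplacian {N : ℕ} {u : RN N → ℝ} (hu : MemD22 u) :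
    MemLp (weakLaplacian u) 2 volume :=
  memLp_finsetSum Finset.univ fun i _ => hu.memLp_weakPartial2 i i

theorem continuous_partial2 {N : ℕ} (i j : Fin N) {φ : RN N → ℝ} (hφ : ContDiff ℝ ∞ φ) :
    Continuous (partial2 i j φ) := by
  have h : Continuous (iteratedFDeriv ℝ 2 φ) := hφ.continuous_iteratedFDeriv (WithTop.coe_le_coe.2 le_top)
  unfold partial2
  fun_prop

theorem hasCompactSupport_partial2 {N : ℕ} (i j : Fin N) {φ : RN N → ℝ}
    (hφ : HasCompactSupport φ) : HasCompactSupport (partial2 i j φ) :=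
  (hφ.iteratedFDeriv (𝕜 := ℝ) 2).mono fun x hx h => hx (by
    rw [partial2, h]
    simp)

theorem MemD22.integral_mul_laplacian {N : ℕ} {u : RN N → ℝ} (hu : MemD22 u)
    (hul : LocallyIntegrable u volume) {φ : RN N → ℝ} (hφ : ContDiff ℝ ∞ φ)
    (hc : HasCompactSupport φ) :
    ∫ x, u x * ∑ i, partial2 i i φ x = ∫ x, weakLaplacian u x * φ x := by
  simp only [Finset.mul_sum, weakLaplacian, Finset.sum_mul]
  rw [integral_finsetSum, integral_finsetSum]
  · exact Finset.sum_congr rfl fun i _ => (hu.isWeakPartial2 i i).integral_eq φ hφ hc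
  · intro i _
    have := (hu.isWeakPartial2 i i).locallyIntegrable_deriv.integrable_smul_left_of_hasCompactSupport
      hφ.continuous hc
    simpa [mul_comm] using this
  · intro i _
    have := hul.integrable_smul_left_of_hasCompactSupport (continuous_partial2 i i hφ)
      (hasCompactSupport_partial2 i i hc)
    simpa [mul_comm] using this

theorem one_le_critExp {N : ℕ} (hN : 5 ≤ N) : 1 ≤ critExp N := by
  have h5 : (5 : ℝ) ≤ N := by exact_mod_cast hN
  rw [critExp, ← ENNReal.ofReal_one]
  refine ENNReal.ofReal_le_ofReal ?_
  rw [le_div_iff₀ (by linarith)]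
  linarith

theorem energy_add_eq_one {N : ℕ} {V : ℝ → ℝ≥0∞} {u : RN N → ℝ} (h1 : normHV V u = 1) :
    (∫⁻ x, ‖weakLaplacian u x‖ₑ ^ 2) + potentialEnergy V u = 1 := by
  rw [normHV] at h1
  have := congrArg (fun t : ℝ≥0∞ => t ^ (2 : ℝ)) h1
  rwa [← ENNReal.rpow_mul, ENNReal.one_rpow, one_div, inv_mul_cancel₀ two_ne_zero,
    ENNReal.rpow_one] at this

/-- The radial decay estimate on the unit sphere of `H²_{V,r}`. -/
theorem exists_decay_const_memHVr {N : ℕ} (hN : 5 ≤ N) (V : ℝ → ℝ≥0∞) : ∃ C : ℝ, 0 ≤ C ∧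
    ∀ u : RN N → ℝ, MemHVr V u → normHV V u = 1 →
      ∀ᵐ x, |u x| ≤ C * ‖x‖ ^ (((4 : ℝ) - N) / 2) := by
  obtain ⟨C, hC, H⟩ := exists_radial_decay_const hN
  refine ⟨C, hC, fun u hu h1 => ?_⟩
  have hD := hu.memD22
  have hul : LocallyIntegrable u volume :=
    (hD.isWeakPartial2 ⟨0, by omega⟩ ⟨0, by omega⟩).locallyIntegrable_fun
  have hx := H u (weakLaplacian u) (critExp N) hul (one_le_critExp hN) ENNReal.ofReal_ne_top
    hD.memLp hD.memLp_weakLaplacian (fun φ hφ hc => hD.integral_mul_laplacian hul hφ hc) hu.radial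
  have hG : Real.sqrt (∫ x, weakLaplacian u x ^ 2) ≤ 1 := by
    rw [← Real.sqrt_one]
    refine Real.sqrt_le_sqrt ?_
    rw [integral_eq_lintegral_of_nonneg_ae (Eventually.of_forall fun x => sq_nonneg _)
      (hD.memLp_weakLaplacian.aestronglyMeasurable.pow 2)]
    refine ENNReal.toReal_le_of_le_ofReal zero_le_one ?_
    rw [ENNReal.ofReal_one, ← energy_add_eq_one h1]
    refine le_trans (lintegral_mono fun x => ?_) le_self_add
    rw [← enorm_pow, Real.enorm_of_nonneg (sq_nonneg _)]
  filter_upwards [hx] with x h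
  refine h.trans ?_
  have : 0 ≤ ‖x‖ ^ (((4 : ℝ) - N) / 2) := by positivity
  gcongr
  exact mul_le_of_le_one_right hC hG

/-! ### Integral estimates outside large balls -/

theorem ENNReal.rpow_sub_one_mul_le_add {a b : ℝ≥0∞} {q : ℝ} (hq : 1 ≤ q) :
    a ^ (q - 1) * b ≤ a ^ q + b ^ q := by
  have e : ∀ c : ℝ≥0∞, c ^ (q - 1) * c = c ^ q := fun c => by
    conv_lhs => rw [← ENNReal.rpow_one c, ← ENNReal.rpow_mul, one_mul]
    rw [← ENNReal.rpow_add_of_nonneg _ _ (by linarith) zero_le_one, sub_add_cancel]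
  have hq' : 0 ≤ q - 1 := by linarith
  rcases le_total a b with h | h
  · calc a ^ (q - 1) * b ≤ b ^ (q - 1) * b := by gcongr
      _ = b ^ q := e b
      _ ≤ _ := le_add_self
  · calc a ^ (q - 1) * b ≤ a ^ (q - 1) * a := by gcongr
      _ = a ^ q := e a
      _ ≤ _ := le_self_add

theorem exists_ae_le_mul_of_essSup_lt_top {N : ℕ} (hN : 1 ≤ N) {V : ℝ → ℝ≥0∞} {K : ℝ → ℝ}
    {R₂ : ℝ} {α β : ℝ}
    (hess : essSup (fun r : ℝ => ENNReal.ofReal (K r) / (ENNReal.ofReal (r ^ α) * V r ^ β))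
      (volume.restrict (Ioi R₂)) < ⊤) :
    ∃ Λ : ℝ≥0∞, Λ ≠ ⊤ ∧ ∀ᵐ x : RN N, R₂ < ‖x‖ →
      ENNReal.ofReal (K ‖x‖) ≤ Λ * (ENNReal.ofReal (‖x‖ ^ α) * V ‖x‖ ^ β) := by
  set F : ℝ → ℝ≥0∞ := fun r => ENNReal.ofReal (K r) / (ENNReal.ofReal (r ^ α) * V r ^ β)
  -- Adding 1 makes `Λ` nonzero, so the division can be cleared even where the denominator is
  -- infinite; `Λ ≠ ⊤` covers a vanishing denominator.
  set Λ := essSup F (volume.restrict (Ioi R₂)) + 1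
  have hΛ : Λ ≠ ⊤ := ENNReal.add_ne_top.2 ⟨hess.ne, ENNReal.one_ne_top⟩
  have hΛ0 : Λ ≠ 0 := (zero_lt_one.trans_le le_add_self).ne'
  refine ⟨Λ, hΛ, ?_⟩
  have h1 : ∀ᵐ r ∂(volume.restrict (Ioi (0 : ℝ))), R₂ < r →
      ENNReal.ofReal (K r) ≤ Λ * (ENNReal.ofReal (r ^ α) * V r ^ β) := by
    refine ae_restrict_of_ae ((ae_restrict_iff' measurableSet_Ioi).1 ?_)
    filter_upwards [ENNReal.ae_le_essSup F] with r hr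
    exact (ENNReal.div_le_iff_le_mul (Or.inr hΛ) (Or.inr hΛ0)).1 (hr.trans le_self_add)
  exact (quasiMeasurePreserving_norm hN).ae h1

/-- One factor supplies smallness in `R`, the other is the Hölder weight; `1 + r ≤ 2r` costs
`2^(n+δ)`. -/
theorem rpow_decay_split_le {r R δ β n : ℝ} (hR : 1 ≤ R) (hr : R ≤ r) (hδ : 0 ≤ δ) (hn : 0 ≤ n)
    (hβ : β ≤ 1) :
    r ^ (-δ - (n + δ) * (1 - β)) ≤
      R ^ (-δ) * (2 ^ (n + δ) * (1 + r) ^ (-(n + δ))) ^ (1 - β) := by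
  have hr0 : 0 < r := by linarith
  have e : r ^ (-δ - (n + δ) * (1 - β)) = r ^ (-δ) * (r ^ (-(n + δ))) ^ (1 - β) := by
    rw [← Real.rpow_mul hr0.le, ← Real.rpow_add hr0]
    congr 1
    ring
  rw [e]
  have h1 : r ^ (-δ) ≤ R ^ (-δ) :=
    Real.rpow_le_rpow_of_nonpos (by linarith) hr (by linarith)
  have h2 : r ^ (-(n + δ)) ≤ 2 ^ (n + δ) * (1 + r) ^ (-(n + δ)) := by
    have h3 : (2 : ℝ) ^ (n + δ) * (2 * r) ^ (-(n + δ)) = r ^ (-(n + δ)) := by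
      rw [Real.mul_rpow two_pos.le hr0.le, ← mul_assoc, ← Real.rpow_add two_pos]
      simp
    rw [← h3]
    gcongr ?_ * ?_
    exact Real.rpow_le_rpow_of_nonpos (by linarith) (by linarith) (by linarith)
  have h4 : 0 ≤ 1 - β := by linarith
  gcongr

theorem aemeasurable_potential_mul_sq {N : ℕ} (hN : 1 ≤ N) {V : ℝ → ℝ≥0∞} (hV : AssumptionV V)
    {u : RN N → ℝ} (hu : MemHVr V u) : AEMeasurable (fun x => V ‖x‖ * ‖u x‖ₑ ^ 2) volume :=
  (hV.aemeasurable.comp_quasiMeasurePreserving (quasiMeasurePreserving_norm hN)).mul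
    (hu.memD22.memLp.aestronglyMeasurable.enorm.pow_const 2)

/-- Decay in `R` of `∫_{|x| ≥ R} K(|x|) |u|^q dx`, uniformly on the unit sphere of `H²_{V,r}`. -/
theorem exists_lintegral_compl_ball_le {N : ℕ} (hN : 5 ≤ N) {V : ℝ → ℝ≥0∞} {K : ℝ → ℝ}
    (hV : AssumptionV V) {R₂ : ℝ} (hR₂ : 0 < R₂) {α β : ℝ} (hβ₀ : 0 ≤ β) (hβ₁ : β ≤ 1)
    (hess : essSup (fun r : ℝ => ENNReal.ofReal (K r) / (ENNReal.ofReal (r ^ α) * V r ^ β))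
      (volume.restrict (Ioi R₂)) < ⊤)
    {q : ℝ} (hqβ : 2 * β < q) (hq : qStar N α β < q) :
    ∃ (D : ℝ≥0∞) (δ : ℝ), D ≠ ⊤ ∧ 0 < δ ∧ ∀ R : ℝ, R₂ + 1 ≤ R → ∀ u : RN N → ℝ,
      MemHVr V u → normHV V u = 1 →
      ∫⁻ x in (Metric.ball (0 : RN N) R)ᶜ, ENNReal.ofReal (K ‖x‖) * ‖u x‖ₑ ^ q
        ≤ D * ENNReal.ofReal (R ^ (-δ)) := by
  obtain ⟨C, hC, hdecay⟩ := exists_decay_const_memHVr hN V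
  obtain ⟨Λ, hΛ, hK⟩ := exists_ae_le_mul_of_essSup_lt_top (N := N) (by omega) hess
  have hN5 : (5 : ℝ) ≤ N := by exact_mod_cast hN
  set e : ℝ := ((4 : ℝ) - N) / 2 with he
  have hγ : α + e * (q - 2 * β) + N * (1 - β) < 0 := by
    rw [qStar, ← mul_div_assoc, div_lt_iff₀ (by linarith)] at hq
    rw [he]
    linarith
  -- The solution of `α + e(q-2β) = -δ - (N+δ)(1-β)`: of the surplus, `δ` goes to `R` and `δ(1-β)`
  -- makes the weight `W` integrable.
  set δ : ℝ := -(α + e * (q - 2 * β) + N * (1 - β)) / (2 - β) with hδ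
  have hδ0 : 0 < δ := div_pos (by linarith) (by linarith)
  have hexp : α + e * (q - 2 * β) = -δ - (N + δ) * (1 - β) := by
    have : δ * (2 - β) = -(α + e * (q - 2 * β) + N * (1 - β)) :=
      div_mul_cancel₀ _ (by linarith)
    linarith
  set W : RN N → ℝ := fun x => 2 ^ ((N : ℝ) + δ) * (1 + ‖x‖) ^ (-((N : ℝ) + δ)) with hW
  have hW0 : ∀ x, 0 ≤ W x := fun x => by positivity
  have hWm : Measurable W := by fun_prop
  set J : ℝ≥0∞ := ∫⁻ x, ENNReal.ofReal (W x) with hJ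
  have hJt : J ≠ ⊤ := by
    have h := finite_integral_one_add_norm (E := RN N) (μ := volume) (r := N + δ)
      (by rw [finrank_euclideanSpace_fin]; linarith)
    simp only [hJ, hW]
    simp_rw [ENNReal.ofReal_mul (by positivity : (0 : ℝ) ≤ 2 ^ ((N : ℝ) + δ))]
    rw [lintegral_const_mul' _ _ ENNReal.ofReal_ne_top]
    exact ENNReal.mul_ne_top ENNReal.ofReal_ne_top h.ne
  refine ⟨Λ * ENNReal.ofReal (C ^ (q - 2 * β)) * J ^ (1 - β), δ,
    ENNReal.mul_ne_top (ENNReal.mul_ne_top hΛ ENNReal.ofReal_ne_top)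
      (ENNReal.rpow_ne_top_of_nonneg (by linarith) hJt), hδ0, fun R hR u hu h1 => ?_⟩
  have hR1 : 1 ≤ R := by linarith
  set A : ℝ≥0∞ := Λ * ENNReal.ofReal (C ^ (q - 2 * β)) * ENNReal.ofReal (R ^ (-δ)) with hA
  have hAt : A ≠ ⊤ :=
    ENNReal.mul_ne_top (ENNReal.mul_ne_top hΛ ENNReal.ofReal_ne_top) ENNReal.ofReal_ne_top
  set v : RN N → ℝ≥0∞ := fun x => V ‖x‖ * ‖u x‖ₑ ^ 2 with hv
  have hpt : ∀ᵐ x ∂(volume.restrict (Metric.ball (0 : RN N) R)ᶜ),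
      ENNReal.ofReal (K ‖x‖) * ‖u x‖ₑ ^ q ≤ A * (v x ^ β * ENNReal.ofReal (W x) ^ (1 - β)) := by
    filter_upwards [ae_restrict_of_ae hK, ae_restrict_of_ae (hdecay u hu h1),
      ae_restrict_mem Metric.isOpen_ball.measurableSet.compl] with x hx hd hxR
    have hr : R ≤ ‖x‖ := by simpa using hxR
    have hr0 : 0 < ‖x‖ := by linarith
    have hu1 : ‖u x‖ₑ ^ (q - 2 * β) ≤
        ENNReal.ofReal (C ^ (q - 2 * β)) * ENNReal.ofReal (‖x‖ ^ (e * (q - 2 * β))) := by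
      rw [← ENNReal.ofReal_mul (by positivity), Real.rpow_mul hr0.le,
        ← Real.mul_rpow hC (by positivity),
        ← ENNReal.ofReal_rpow_of_nonneg (by positivity) (by linarith)]
      refine ENNReal.rpow_le_rpow ?_ (by linarith)
      rw [← ofReal_norm]
      exact ENNReal.ofReal_le_ofReal hd
    have hu2 : ‖u x‖ₑ ^ q = (‖u x‖ₑ ^ 2) ^ β * ‖u x‖ₑ ^ (q - 2 * β) := by
      rw [← ENNReal.rpow_natCast, ← ENNReal.rpow_mul,
        ← ENNReal.rpow_add_of_nonneg _ _ (by positivity) (by linarith)]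
      congr 1
      push_cast
      ring
    have hpow : ENNReal.ofReal (‖x‖ ^ α) * ENNReal.ofReal (‖x‖ ^ (e * (q - 2 * β)))
        ≤ ENNReal.ofReal (R ^ (-δ)) * ENNReal.ofReal (W x) ^ (1 - β) := by
      rw [← ENNReal.ofReal_mul (by positivity), ← Real.rpow_add hr0, hexp,
        ENNReal.ofReal_rpow_of_nonneg (hW0 x) (by linarith), ← ENNReal.ofReal_mul (by positivity)]
      exact ENNReal.ofReal_le_ofReal
        (rpow_decay_split_le hR1 hr hδ0.le (Nat.cast_nonneg N) hβ₁)
    calc ENNReal.ofReal (K ‖x‖) * ‖u x‖ₑ ^ q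
        ≤ (Λ * (ENNReal.ofReal (‖x‖ ^ α) * V ‖x‖ ^ β)) * ((‖u x‖ₑ ^ 2) ^ β *
          (ENNReal.ofReal (C ^ (q - 2 * β)) * ENNReal.ofReal (‖x‖ ^ (e * (q - 2 * β))))) := by
          rw [hu2]
          gcongr
          exact hx (by linarith)
      _ = Λ * ENNReal.ofReal (C ^ (q - 2 * β)) * v x ^ β *
          (ENNReal.ofReal (‖x‖ ^ α) * ENNReal.ofReal (‖x‖ ^ (e * (q - 2 * β)))) := by
          rw [hv, ENNReal.mul_rpow_of_nonneg _ _ hβ₀]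
          ring
      _ ≤ Λ * ENNReal.ofReal (C ^ (q - 2 * β)) * v x ^ β *
          (ENNReal.ofReal (R ^ (-δ)) * ENNReal.ofReal (W x) ^ (1 - β)) := by gcongr
      _ = _ := by
          rw [hA]
          ring
  have hPE : ∫⁻ x, v x ≤ 1 := by
    rw [← energy_add_eq_one h1]
    exact le_add_self
  calc ∫⁻ x in (Metric.ball (0 : RN N) R)ᶜ, ENNReal.ofReal (K ‖x‖) * ‖u x‖ₑ ^ q
      ≤ ∫⁻ x in (Metric.ball (0 : RN N) R)ᶜ, A * (v x ^ β * ENNReal.ofReal (W x) ^ (1 - β)) :=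
        lintegral_mono_ae hpt
    _ ≤ ∫⁻ x, A * (v x ^ β * ENNReal.ofReal (W x) ^ (1 - β)) := setLIntegral_le_lintegral _ _
    _ = A * ∫⁻ x, v x ^ β * ENNReal.ofReal (W x) ^ (1 - β) := lintegral_const_mul' _ _ hAt
    _ ≤ A * ((∫⁻ x, v x) ^ β * J ^ (1 - β)) := by
        gcongr
        -- Hölder with weights `β` and `1-β`, in a form that admits the endpoints 0 and 1.
        exact ENNReal.lintegral_mul_norm_pow_le (aemeasurable_potential_mul_sq (by omega) hV hu)
          hWm.ennreal_ofReal.aemeasurable hβ₀ (by linarith) (by ring)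
    _ ≤ A * (1 ^ β * J ^ (1 - β)) := by gcongr
    _ = _ := by
        rw [ENNReal.one_rpow, one_mul, hA]
        ring

/-! ### Conclusion -/

theorem theorem3 (N : ℕ) (hN : 5 ≤ N) (V : ℝ → ℝ≥0∞) (K : ℝ → ℝ)
    (hV : AssumptionV V) (hK : AssumptionK K)
    (R₂ : ℝ) (hR₂ : 0 < R₂)
    (hVfin : ∀ᵐ r ∂(volume.restrict (Ioi R₂)), V r < ⊤)
    (α β : ℝ) (hβ₀ : 0 ≤ β) (hβ₁ : β ≤ 1)
    (hess : essSup (fun r : ℝ => ENNReal.ofReal (K r) / (ENNReal.ofReal (r ^ α) * V r ^ β))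
      (volume.restrict (Ioi R₂)) < ⊤)
    (q₂ : ℝ) (hq₂ : max 1 (max (2 * β) (qStar N α β)) < q₂) :
    Tendsto (fun R : ℝ => Rinfty N V K q₂ R) atTop (𝓝 0) := by
  obtain ⟨hq1, hqβ, hq⟩ : 1 < q₂ ∧ 2 * β < q₂ ∧ qStar N α β < q₂ := by simpa using hq₂
  obtain ⟨D, δ, hD, hδ, H⟩ := exists_lintegral_compl_ball_le hN hV hR₂ hβ₀ hβ₁ hess hqβ hq
  have hlim : Tendsto (fun R : ℝ => D * ENNReal.ofReal (R ^ (-δ)) + D * ENNReal.ofReal (R ^ (-δ)))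
      atTop (𝓝 0) := by
    have h1 : Tendsto (fun R : ℝ => ENNReal.ofReal (R ^ (-δ))) atTop (𝓝 0) := by
      simpa using ENNReal.tendsto_ofReal (tendsto_rpow_neg_atTop hδ)
    have h2 := ENNReal.Tendsto.const_mul h1 (Or.inr hD)
    simpa using h2.add h2
  refine tendsto_of_tendsto_of_tendsto_of_le_of_le' tendsto_const_nhds hlim
    (Eventually.of_forall fun R => zero_le) ?_
  filter_upwards [eventually_ge_atTop (R₂ + 1)] with R hR
  refine iSup_le fun u => iSup_le fun h => iSup_le fun hu => iSup_le fun hh =>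
    iSup_le fun hu1 => iSup_le fun hh1 => ?_
  have hKm : AEMeasurable (fun x : RN N => ENNReal.ofReal (K ‖x‖)) volume :=
    hK.aemeasurable.ennreal_ofReal.comp_quasiMeasurePreserving
      (quasiMeasurePreserving_norm (by omega))
  have hm : AEMeasurable (fun x => ENNReal.ofReal (K ‖x‖) * ‖u x‖ₑ ^ q₂) volume :=
    hKm.mul (hu.memD22.memLp.aestronglyMeasurable.enorm.pow_const q₂)
  calc ∫⁻ x in (Metric.ball (0 : RN N) R)ᶜ,
        ENNReal.ofReal (K ‖x‖) * ‖u x‖ₑ ^ (q₂ - 1) * ‖h x‖ₑ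
      ≤ ∫⁻ x in (Metric.ball (0 : RN N) R)ᶜ,
        (ENNReal.ofReal (K ‖x‖) * ‖u x‖ₑ ^ q₂ + ENNReal.ofReal (K ‖x‖) * ‖h x‖ₑ ^ q₂) := by
        refine lintegral_mono fun x => ?_
        simp only
        rw [mul_assoc, ← mul_add]
        gcongr
        exact ENNReal.rpow_sub_one_mul_le_add hq1.le
    _ = _ := lintegral_add_left' hm.restrict _
    _ ≤ _ := add_le_add (H R hR u hu hu1) (H R hR h hh hh1)
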